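/- Conventions. All lattices have a bottom element $0$ and a top element $1$ (possibly $0=1$), sublattices contain $0$ and $1$, and lattice homomorphisms preserve $0$ and $1$. For a family $S$ of subsets of a set $X$, let $\mathcal T^+$ (resp. $\mathcal T^-$) be the topology on $S$ with subbase $\{\{p\in S: x\notin p\}: x\in X\}$ (resp. $\{\{p\in S: x\in p\}: x\in X\}$). For a bitopological space $(S,\mathcal T^+,\mathcal T^-)$ put $\mathcal L^+=\{U\in\mathcal T^+: S\setminus U\in\mathcal T^-\}$ and $\mathcal L^-=\{U\in\mathcal T^-: S\setminus U\in\mathcal T^+\}$. A non-empty bitopological space is an *abstract spectrum* if $\mathcal L^+$ is a base of $\mathcal T^+$ and $\mathcal L^-$ is a base of $\mathcal T^-$; every $\mathcal T^+$-closed set is $\mathcal T^-$-compact and every $\mathcal T^-$-closed set is $\mathcal T^+$-compact (compactness does not include the Hausdorff property); and at least one of $\mathcal T^+$, $\mathcal T^-$ is $T_0$. An *$\mathbf S$-morphism* is a map that is continuous both for the topologies $\mathcal T^+$ and for the topologies $\mathcal T^-$; an *$\mathbf S$-isomorphism* is an $\mathbf S$-morphism with a two-sided inverse that is an $\mathbf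 S$-morphism. For a distributive lattice $L$, $\operatorname{spec}(L)$ is the set of proper prime ideals of $L$ with the topologies $\mathcal T^\pm$ above (as a family of subsets of $L$). Theorem 2.4.1. Let $X$ be a set and $S$ a family of subsets of $X$ such that $(S,\mathcal T^+,\mathcal T^-)$ is an abstract spectrum. Then there exist a distributive lattice $L$ with $0$ and $1$ and a function $\varphi:X\to L$ such that: (i) $\varphi(X)$ generates $L$ (as a lattice with $0$ and $1$); (ii) $\varphi^{-1}(q)\in S$ for every $q\in\operatorname{spec}(L)$; (iii) $\operatorname{spec}(L)$ is an abstract spectrum and $\Phi:\operatorname{spec}(L)\to S$, $q\mapsto\varphi^{-1}(q)$, is an $\mathbf S$-isomorphism; (iv) if $L'$ is a distributive lattice with $0$ and $1$ and $\theta:X\to L'$ is a function such that $\theta^{-1}(q)\in S$ for every $q\in\operatorname{spec}(L')$ and $\Theta:\operatorname{spec}(L')\to S$, $q\mapsto\theta^{-1}(q)$, is an $\mathbf S$-morphism, then there exists a unique lattice homomorphism $l:L\to L'$ with $l\circ\varphi=\theta$; (v) if $L_1$ is a distributive lattice with $0$ and $1$ and $\varphi_1:X\to L_1$ is a function such that $\varphi_1^{-1}(q)\in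 S$ for every $q\in\operatorname{spec}(L_1)$ and $\Phi_1:\operatorname{spec}(L_1)\to S$, $q\mapsto\varphi_1^{-1}(q)$, is an $\mathbf S$-isomorphism, then there exists a unique lattice isomorphism $l:L\to L_1$ with $l\circ\varphi=\varphi_1$; (vi) $\varphi$ is injective if and only if for any two different points $x,y\in X$ there exists a $p\in S$ containing exactly one of them. -/

import Mathlib

open scoped Topology

universe u v

namespace Spectra

/-- A bitopology `(𝒯⁺, 𝒯⁻)` on a type. -/
structure Bitopology (A : Type u) where
  pos : TopologicalSpace A
  neg : TopologicalSpace A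

namespace Bitopology

variable {A : Type u} {B : Type v}

/-- `ℒ⁺`: the `𝒯⁺`-open sets whose complement is `𝒯⁻`-open. -/
def posClopen (T : Bitopology A) : Set (Set A) :=
  {U | IsOpen[T.pos] U ∧ IsOpen[T.neg] Uᶜ}

/-- `ℒ⁻`: the `𝒯⁻`-open sets whose complement is `𝒯⁺`-open. -/
def negClopen (T : Bitopology A) : Set (Set A) :=
  {U | IsOpen[T.neg] U ∧ IsOpen[T.pos] Uᶜ}

/-- Abstract spectra. -/
structure IsAbstractSpectrum (T : Bitopology A) : Prop where
  nonempty : Nonempty A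
  basis_pos : @TopologicalSpace.IsTopologicalBasis A T.pos T.posClopen
  basis_neg : @TopologicalSpace.IsTopologicalBasis A T.neg T.negClopen
  compact_neg : ∀ F : Set A, IsOpen[T.pos] Fᶜ → @IsCompact A T.neg F
  compact_pos : ∀ F : Set A, IsOpen[T.neg] Fᶜ → @IsCompact A T.pos F
  t0 : @T0Space A T.pos ∨ @T0Space A T.neg

/-- `f` is continuous for both topologies (an `𝐒`-morphism, for maps of abstract spectra). -/
def IsMorphism (T : Bitopology A) (T' : Bitopology B) (f : A → B) : Prop :=
  Continuous[T.pos, T'.pos] f ∧ Continuous[T.neg, T'.neg] f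

/-- `f` is a morphism with a two-sided inverse that is a morphism. -/
def IsIsomorphism (T : Bitopology A) (T' : Bitopology B) (f : A → B) : Prop :=
  T.IsMorphism T' f ∧
    ∃ g : B → A, T'.IsMorphism T g ∧ Function.LeftInverse g f ∧ Function.RightInverse g f

end Bitopology

/-- The bitopology on a family `S` of subsets of `X`: the sets `{p ∈ S : x ∉ p}` form a subbase of
`𝒯⁺` and the sets `{p ∈ S : x ∈ p}` form a subbase of `𝒯⁻`. -/
def familyBitopology {X : Type u} (S : Set (Set X)) : Bitopology S where
  pos := TopologicalSpace.generateFrom (Set.range fun x : X => {p : S | x ∉ (p : Set X)})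
  neg := TopologicalSpace.generateFrom (Set.range fun x : X => {p : S | x ∈ (p : Set X)})

/-- The set of all (proper) prime ideals of a lattice, as a family of subsets of it. As a
bitopological space it carries `familyBitopology (spec L)`, whose `𝒯⁺` is the Stone topology. -/
def spec (L : Type u) [Lattice L] : Set (Set L) :=
  {q | ∃ I : Order.Ideal L, I.IsPrime ∧ (I : Set L) = q}

/-- The map `spec L → S`, `q ↦ θ⁻¹(q)`. -/
def specMap {X : Type u} {L : Type v} [Lattice L] {S : Set (Set X)} (θ : X → L)
    (h : ∀ q ∈ spec L, θ ⁻¹' q ∈ S) : spec L → S :=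
  fun q => ⟨θ ⁻¹' q, h q q.2⟩

/-- `G` generates `L` as a lattice with `0` and `1`: the only sublattice of `L` that contains
`0`, `1` and `G` is `L` itself. -/
def Generates {L : Type u} [Lattice L] [BoundedOrder L] (G : Set L) : Prop :=
  ∀ M : Sublattice L, ⊥ ∈ M → ⊤ ∈ M → G ⊆ M → M = ⊤

end Spectra

/-! Take `L = ℒ⁺` and send `x` to `{p ∈ S : x ∉ p}`. A point `p` gives the prime ideal of the
members of `ℒ⁺` that miss `p`; compactness makes every prime ideal of this form
(`exists_eq_pointIdeal`), so `spec L` is `S` again. Compactness also makes each member of `ℒ⁺` a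
finite join of finite meets of subbasic sets (`generates_range_avoiding`). An element of a
distributive lattice is determined by the prime ideals containing it (`eq_of_forall_spec`). Hence
the homomorphism induced by `θ` can be specified by `l U ∈ q ↔ θ⁻¹(q) ∉ U`: such elements exist on
the generators, hence everywhere. An isomorphism `spec L₁ → S` makes `l` bijective. -/

namespace Spectra

/-! ### Invariance under isomorphism -/

namespace Bitopology

variable {A : Type u} {B : Type v} {T : Bitopology A} {T' : Bitopology B}

theorem IsMorphism.preimage_mem_posClopen {f : A → B} (hf : T.IsMorphism T' f) {U : Set B}
    (hU : U ∈ T'.posClopen) : f ⁻¹' U ∈ T.posClopen :=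
  ⟨continuous_def.1 hf.1 _ hU.1, continuous_def.1 hf.2 _ hU.2⟩

theorem IsMorphism.preimage_mem_negClopen {f : A → B} (hf : T.IsMorphism T' f) {U : Set B}
    (hU : U ∈ T'.negClopen) : f ⁻¹' U ∈ T.negClopen :=
  ⟨continuous_def.1 hf.2 _ hU.1, continuous_def.1 hf.1 _ hU.2⟩

theorem isTopologicalBasis_of_leftInverse [TopologicalSpace A] [TopologicalSpace B]
    {f : A → B} {g : B → A} (hg : Continuous g)
    (hgf : Function.LeftInverse g f) {V : Set (Set A)} {W : Set (Set B)}
    (hW : TopologicalSpace.IsTopologicalBasis W) (hV : ∀ U ∈ V, IsOpen U)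
    (hWV : ∀ U ∈ W, f ⁻¹' U ∈ V) : TopologicalSpace.IsTopologicalBasis V := by
  refine TopologicalSpace.isTopologicalBasis_of_isOpen_of_nhds hV fun a U ha hU => ?_
  obtain ⟨w, hw, haw, hwU⟩ := hW.exists_subset_of_mem_open
    (show f a ∈ g ⁻¹' U by simpa [hgf a] using ha) (hU.preimage hg)
  refine ⟨_, hWV w hw, haw, fun b hb => ?_⟩
  simpa [hgf b] using hwU hb

/-- Being an abstract spectrum is invariant under isomorphism. -/
theorem IsAbstractSpectrum.of_isIsomorphism {f : A → B} (h : T'.IsAbstractSpectrum)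
    (hf : T.IsIsomorphism T' f) : T.IsAbstractSpectrum := by
  obtain ⟨hf, g, hg, hgf, hfg⟩ := hf
  refine ⟨h.nonempty.map g, ?_, ?_, fun F hF => ?_, fun F hF => ?_, ?_⟩
  · exact @isTopologicalBasis_of_leftInverse A B T.pos T'.pos f g hg.1 hgf _ _ h.basis_pos
      (fun U hU => hU.1) fun U hU => hf.preimage_mem_posClopen hU
  · exact @isTopologicalBasis_of_leftInverse A B T.neg T'.neg f g hg.2 hgf _ _ h.basis_neg
      (fun U hU => hU.1) fun U hU => hf.preimage_mem_negClopen hU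
  · rw [← Set.image_preimage_eq F hgf.surjective]
    exact @IsCompact.image _ _ T'.neg T.neg _ _
      (h.compact_neg _ (continuous_def.1 hg.1 _ hF)) hg.2
  · rw [← Set.image_preimage_eq F hgf.surjective]
    exact @IsCompact.image _ _ T'.pos T.pos _ _
      (h.compact_pos _ (continuous_def.1 hg.2 _ hF)) hg.1
  · refine h.t0.imp (fun h0 => ?_) fun h0 => ?_
    · exact @t0Space_of_injective_of_continuous _ _ T.pos T'.pos _ hgf.injective hf.1 h0
    · exact @t0Space_of_injective_of_continuous _ _ T.neg T'.neg _ hgf.injective hf.2 h0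

/-! ### Points and prime ideals of `ℒ⁺` -/

/-- The lattice `ℒ⁺` of a bitopological space. -/
def posLattice (T : Bitopology A) : Sublattice (Set A) where
  carrier := T.posClopen
  supClosed' U hU V hV := by
    refine ⟨@IsOpen.union _ _ _ T.pos hU.1 hV.1, ?_⟩
    rw [show (U ⊔ V)ᶜ = Uᶜ ∩ Vᶜ from Set.compl_union U V]
    exact @IsOpen.inter _ T.neg _ _ hU.2 hV.2
  infClosed' U hU V hV := by
    refine ⟨@IsOpen.inter _ T.pos _ _ hU.1 hV.1, ?_⟩
    rw [show (U ⊓ V)ᶜ = Uᶜ ∪ Vᶜ from Set.compl_inter U V]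
    exact @IsOpen.union _ _ _ T.neg hU.2 hV.2

instance (T : Bitopology A) : BoundedOrder T.posLattice where
  top := ⟨Set.univ, @isOpen_univ _ T.pos, by
    rw [Set.compl_univ]; exact @isOpen_empty _ T.neg⟩
  le_top U := Set.subset_univ (U : Set A)
  bot := ⟨∅, @isOpen_empty _ T.pos, by
    rw [Set.compl_empty]; exact @isOpen_univ _ T.neg⟩
  bot_le U := Set.empty_subset (U : Set A)

/-- The prime ideal of `ℒ⁺` formed by the sets that do not contain a given point. -/
def pointIdeal (T : Bitopology A) (a : A) : Order.Ideal T.posLattice where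
  carrier := {U | a ∉ (U : Set A)}
  lower' _ _ hVU hU hV := hU (hVU hV)
  nonempty' := ⟨⊥, Set.notMem_empty a⟩
  directed' U hU V hV := ⟨U ⊔ V, fun h => Or.elim h hU hV,
    le_sup_left (a := U), le_sup_right (b := V)⟩

theorem mem_pointIdeal {a : A} {U : T.posLattice} : U ∈ T.pointIdeal a ↔ a ∉ (U : Set A) :=
  Iff.rfl

theorem pointIdeal_isPrime (T : Bitopology A) (a : A) : (T.pointIdeal a).IsPrime := by
  have : (T.pointIdeal a).IsProper :=
    Order.Ideal.isProper_of_notMem (p := ⊤) fun h => h (Set.mem_univ a)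
  refine Order.Ideal.IsPrime.of_mem_or_mem fun {U V} h => ?_
  simp only [mem_pointIdeal] at h ⊢
  by_contra! hc
  exact h hc

/-- Every prime ideal of `ℒ⁺` of an abstract spectrum comes from a point. -/
theorem IsAbstractSpectrum.exists_eq_pointIdeal (h : T.IsAbstractSpectrum)
    {I : Order.Ideal T.posLattice} (hI : I.IsPrime) : ∃ a, I = T.pointIdeal a := by
  -- A point of `F` lying in every `V ∉ I` is wanted. If `V` missed `F`, then `𝒯⁺`-compactness of
  -- `V` and directedness of `I` would put `V` below a single `U ∈ I`.
  set F : Set A := ⋂ U : I, ((U : T.posLattice) : Set A)ᶜ with hFdef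
  have hF : ∀ V : T.posLattice, V ∉ I → ((V : Set A) ∩ F).Nonempty := by
    intro V hV
    rw [Set.nonempty_iff_ne_empty]
    intro hemp
    have : Nonempty I := I.nonempty.to_subtype
    obtain ⟨U, hU⟩ := @IsCompact.elim_directed_family_closed _ T.pos _ I _
      (h.compact_pos V V.2.2) _
      (fun U => by
        rw [← @isOpen_compl_iff _ _ T.pos, compl_compl]
        exact (U : T.posLattice).2.1) hemp
      (fun U W => ⟨⟨U ⊔ W, Order.Ideal.sup_mem U.2 W.2⟩,
        Set.compl_subset_compl.2 (le_sup_left (a := (U : T.posLattice)) (b := (W : T.posLattice))),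
        Set.compl_subset_compl.2
          (le_sup_right (a := (U : T.posLattice)) (b := (W : T.posLattice)))⟩)
    refine hV (I.lower (fun a ha => ?_) U.2)
    by_contra haU
    exact (Set.mem_empty_iff_false a).1 (hU ▸ ⟨ha, haU⟩)
  have hFc : @IsCompact A T.neg F := by
    refine h.compact_neg F ?_
    rw [hFdef, Set.compl_iInter]
    refine @isOpen_iUnion _ _ T.pos _ fun U => ?_
    rw [compl_compl]
    exact (U : T.posLattice).2.1
  -- `F` is `𝒯⁻`-compact and the sets `V ∉ I` are `𝒯⁻`-closed; primality of `I` makes them closed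
  -- under intersection.
  have hne : (F ∩ ⋂ V : {V : T.posLattice // V ∉ I}, ((V : T.posLattice) : Set A)).Nonempty := by
    rw [Set.nonempty_iff_ne_empty]
    intro hemp
    have : Nonempty {V : T.posLattice // V ∉ I} :=
      ⟨⊤, hI.toIsProper.top_notMem⟩
    obtain ⟨V, hV⟩ := @IsCompact.elim_directed_family_closed _ T.neg _ _ _ hFc _
      (fun V => by
        rw [← @isOpen_compl_iff _ _ T.neg]
        exact (V : T.posLattice).2.2) hemp
      (fun V W => ⟨⟨V ⊓ W, fun hVW => (hI.mem_or_mem hVW).elim V.2 W.2⟩,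
        inf_le_left (a := (V : T.posLattice)) (b := (W : T.posLattice)),
        inf_le_right (a := (V : T.posLattice)) (b := (W : T.posLattice))⟩)
    obtain ⟨a, haV, haF⟩ := hF V V.2
    exact (Set.mem_empty_iff_false a).1 (hV ▸ ⟨haF, haV⟩)
  obtain ⟨a, haF, haV⟩ := hne
  refine ⟨a, Order.Ideal.ext (Set.ext fun U => ⟨fun hU => ?_, fun hU => ?_⟩)⟩
  · exact Set.mem_iInter.1 haF ⟨U, hU⟩
  · by_contra hUI
    exact hU (Set.mem_iInter.1 haV ⟨U, hUI⟩)

end Bitopology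

/-! ### The generating map and the isomorphism `spec ℒ⁺ → S` -/

section

variable {X : Type u} {S : Set (Set X)} {L : Type v}

/-- The subbasic set of `x` pulls back to the subbasic set of `θ x`. -/
theorem isMorphism_specMap [Lattice L] (θ : X → L) (h : ∀ q ∈ spec L, θ ⁻¹' q ∈ S) :
    (familyBitopology (spec L)).IsMorphism (familyBitopology S) (specMap θ h) := by
  constructor
  · refine continuous_generateFrom_iff.2 ?_
    rintro _ ⟨x, rfl⟩
    exact TopologicalSpace.isOpen_generateFrom_of_mem ⟨θ x, rfl⟩
  · refine continuous_generateFrom_iff.2 ?_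
    rintro _ ⟨x, rfl⟩
    exact TopologicalSpace.isOpen_generateFrom_of_mem ⟨θ x, rfl⟩

/-- The set of the members of `S` that do not contain `x`, as an element of `ℒ⁺`. -/
def avoiding (S : Set (Set X)) (x : X) : (familyBitopology S).posLattice :=
  ⟨{p | x ∉ (p : Set X)}, TopologicalSpace.isOpen_generateFrom_of_mem ⟨x, rfl⟩, by
    rw [show {p : S | x ∉ (p : Set X)}ᶜ = {p : S | x ∈ (p : Set X)} by ext; simp]
    exact TopologicalSpace.isOpen_generateFrom_of_mem ⟨x, rfl⟩⟩

theorem mem_avoiding {x : X} {p : S} : p ∈ (avoiding S x : Set S) ↔ x ∉ (p : Set X) := Iff.rfl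

theorem avoiding_injective_iff : Function.Injective (avoiding S) ↔
    ∀ x y : X, x ≠ y → ∃ p ∈ S, Xor (x ∈ p) (y ∈ p) := by
  refine forall₂_congr fun x y => ?_
  rw [← not_imp_not, ← ne_eq, ← ne_eq]
  refine imp_congr_right fun _ => ?_
  rw [ne_eq, Subtype.ext_iff, Set.ext_iff, not_forall, Subtype.exists]
  simp only [mem_avoiding, not_iff_not, xor_iff_not_iff, exists_prop]

theorem preimage_avoiding_pointIdeal (p : S) :
    avoiding S ⁻¹' ((familyBitopology S).pointIdeal p) = p := by
  ext x
  exact not_not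

/-- In an abstract spectrum given by a family of sets, `ℒ⁺` is generated by the subbasic sets. -/
theorem generates_range_avoiding (hS : (familyBitopology S).IsAbstractSpectrum) :
    Generates (Set.range (avoiding S)) := by
  intro M hbot htop hM
  refine eq_top_iff.2 fun U _ => ?_
  have hinter : ∀ F : Set (Set S), F.Finite → F ⊆ Set.range (fun x => {p : S | x ∉ (p : Set X)}) →
      ∃ V ∈ M, (V : Set S) = ⋂₀ F := by
    intro F hF
    induction F, hF using Set.Finite.induction_on with
    | empty => exact fun _ => ⟨⊤, htop, by rw [Set.sInter_empty]; rfl⟩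
    | insert _ _ ih =>
      intro hsub
      obtain ⟨V, hV, hVF⟩ := ih ((Set.subset_insert _ _).trans hsub)
      obtain ⟨x, rfl⟩ := hsub (Set.mem_insert _ _)
      refine ⟨avoiding S x ⊓ V, M.inf_mem (hM ⟨x, rfl⟩) hV, ?_⟩
      rw [Set.sInter_insert, ← hVF]
      rfl
  have hnhds : ∀ p ∈ (U : Set S), ∃ V ∈ M, p ∈ (V : Set S) ∧ V ≤ U := by
    intro p hp
    obtain ⟨_, ⟨F, ⟨hF, hsub⟩, rfl⟩, hpF, hFU⟩ :=
      @TopologicalSpace.IsTopologicalBasis.exists_subset_of_mem_open _ (familyBitopology S).pos _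
        (@TopologicalSpace.isTopologicalBasis_of_subbasis _ (familyBitopology S).pos _ rfl)
        _ _ hp U.2.1
    obtain ⟨V, hV, hVF⟩ := hinter F hF hsub
    exact ⟨V, hV, hVF ▸ hpF, fun a ha => hFU (hVF.subset ha)⟩
  choose! V hVM hpV hVU using hnhds
  -- The complement of `U` is `𝒯⁻`-open, so `U` is `𝒯⁺`-compact and finitely many of the `V p`
  -- suffice.
  obtain ⟨t, ht⟩ := @IsCompact.elim_finite_subcover _ (familyBitopology S).pos _
    (U : Set S) (hS.compact_pos U U.2.2) (fun p : (U : Set S) => (V p : Set S))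
    (fun p => (V p).2.1) fun p hp => Set.mem_iUnion.2 ⟨⟨p, hp⟩, hpV p hp⟩
  have hsup : t.sup (fun p => V p) = U := by
    refine le_antisymm (Finset.sup_le fun p _ => hVU p p.2) fun a ha => ?_
    obtain ⟨p, hp, hap⟩ := Set.mem_iUnion₂.1 (ht ha)
    exact Finset.le_sup (f := fun p : (U : Set S) => V p) hp hap
  rw [← hsup]
  exact Finset.sup_induction hbot (fun _ ha _ hb => M.sup_mem ha hb) fun p _ => hVM p p.2

theorem preimage_avoiding_mem (hS : (familyBitopology S).IsAbstractSpectrum) :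
    ∀ q ∈ spec (familyBitopology S).posLattice, avoiding S ⁻¹' q ∈ S := by
  rintro _ ⟨I, hI, rfl⟩
  obtain ⟨p, rfl⟩ := hS.exists_eq_pointIdeal hI
  rw [preimage_avoiding_pointIdeal]
  exact p.2

theorem isIsomorphism_specMap_avoiding (hS : (familyBitopology S).IsAbstractSpectrum) :
    (familyBitopology (spec (familyBitopology S).posLattice)).IsIsomorphism (familyBitopology S)
      (specMap (avoiding S) (preimage_avoiding_mem hS)) := by
  refine ⟨isMorphism_specMap _ _, fun p => ⟨(familyBitopology S).pointIdeal p, _,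
    (familyBitopology S).pointIdeal_isPrime p, rfl⟩, ⟨?_, ?_⟩, ?_, ?_⟩
  -- Under `p ↦ pointIdeal p`, the ideals avoiding `U` pull back to `U` and those containing `U` to
  -- its complement.
  · refine continuous_generateFrom_iff.2 ?_
    rintro _ ⟨U, rfl⟩
    convert U.2.1 using 1
    ext p
    exact not_not
  · refine continuous_generateFrom_iff.2 ?_
    rintro _ ⟨U, rfl⟩
    exact U.2.2
  · rintro ⟨_, I, hI, rfl⟩
    obtain ⟨p, rfl⟩ := hS.exists_eq_pointIdeal hI
    refine Subtype.ext ?_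
    refine congrArg (fun p : S =>
      ((familyBitopology S).pointIdeal p : Set (familyBitopology S).posLattice)) ?_
    exact Subtype.ext (preimage_avoiding_pointIdeal p)
  · exact fun p => Subtype.ext (preimage_avoiding_pointIdeal p)

/-! ### Separation by prime ideals and the induced homomorphism -/

variable [DistribLattice L]

/-- If `a ≰ b`, the filter above `a` and the ideal below `b` are disjoint, so a prime ideal
separates them. -/
theorem le_of_forall_spec {a b : L} (h : ∀ q ∈ spec L, b ∈ q → a ∈ q) : a ≤ b := by
  by_contra hab
  obtain ⟨J, hJ, hbJ, hdisj⟩ := DistribLattice.prime_ideal_of_disjoint_filter_ideal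
    (F := Order.PFilter.principal a) (I := Order.Ideal.principal b)
    (Set.disjoint_left.2 fun c hac hcb => hab (le_trans hac hcb))
  exact Set.disjoint_left.1 hdisj (show a ∈ Order.PFilter.principal a from le_refl a)
    (h J ⟨J, hJ, rfl⟩ (hbJ (Order.Ideal.mem_principal_self)))

theorem eq_of_forall_spec {a b : L} (h : ∀ q ∈ spec L, a ∈ q ↔ b ∈ q) : a = b :=
  le_antisymm (le_of_forall_spec fun q hq => (h q hq).2)
    (le_of_forall_spec fun q hq => (h q hq).1)

theorem sup_mem_spec {q : Set L} (hq : q ∈ spec L) {a b : L} : a ⊔ b ∈ q ↔ a ∈ q ∧ b ∈ q := by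
  obtain ⟨I, -, rfl⟩ := hq
  exact Order.Ideal.sup_mem_iff

theorem inf_mem_spec {q : Set L} (hq : q ∈ spec L) {a b : L} : a ⊓ b ∈ q ↔ a ∈ q ∨ b ∈ q := by
  obtain ⟨I, hI, rfl⟩ := hq
  exact ⟨hI.mem_or_mem, fun h => h.elim (I.lower inf_le_left) (I.lower inf_le_right)⟩

theorem comp_avoiding_eq {θ : X → L} {h : ∀ q ∈ spec L, θ ⁻¹' q ∈ S}
    {l : (familyBitopology S).posLattice → L}
    (hl : ∀ U, ∀ q : spec L, l U ∈ (q : Set L) ↔ specMap θ h q ∉ (U : Set S)) :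
    l ∘ avoiding S = θ := by
  funext x
  exact eq_of_forall_spec fun q hq => (hl (avoiding S x) ⟨q, hq⟩).trans not_not

theorem bijective_of_isIsomorphism {θ : X → L} {h : ∀ q ∈ spec L, θ ⁻¹' q ∈ S}
    (hiso : (familyBitopology (spec L)).IsIsomorphism (familyBitopology S) (specMap θ h))
    {l : (familyBitopology S).posLattice → L}
    (hl : ∀ U, ∀ q : spec L, l U ∈ (q : Set L) ↔ specMap θ h q ∉ (U : Set S)) :
    Function.Bijective l := by
  obtain ⟨-, g, hg, hgf, hfg⟩ := hiso
  refine ⟨fun U V hUV => Subtype.ext (Set.ext fun p => ?_), fun a => ?_⟩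
  · obtain ⟨q, rfl⟩ := hfg.surjective p
    rw [← not_iff_not, ← hl, ← hl, hUV]
  -- The preimage of `a` is the set `{q : a ∉ q}` carried over to `S` by the inverse `g`.
  · refine ⟨⟨_, hg.preimage_mem_posClopen (avoiding (spec L) a).2⟩, ?_⟩
    refine eq_of_forall_spec fun q hq => (hl _ ⟨q, hq⟩).trans ?_
    rw [Set.mem_preimage, hgf, mem_avoiding, not_not]

variable [BoundedOrder L]

theorem bot_mem_spec {q : Set L} (hq : q ∈ spec L) : ⊥ ∈ q := by
  obtain ⟨I, -, rfl⟩ := hq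
  exact I.bot_mem

theorem top_notMem_spec {q : Set L} (hq : q ∈ spec L) : ⊤ ∉ q := by
  obtain ⟨I, hI, rfl⟩ := hq
  exact hI.toIsProper.top_notMem

/-- The preimage in `spec L` of an element of `ℒ⁺` is the set of the prime ideals that avoid some
element of `L`. -/
theorem exists_forall_mem_spec_iff (hS : (familyBitopology S).IsAbstractSpectrum) (θ : X → L)
    (h : ∀ q ∈ spec L, θ ⁻¹' q ∈ S) (U : (familyBitopology S).posLattice) :
    ∃ a : L, ∀ q : spec L, a ∈ (q : Set L) ↔ specMap θ h q ∉ (U : Set S) := by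
  -- The `U` admitting such an `a` form a sublattice: on prime ideals, joins and meets of the `a`
  -- follow De Morgan's laws.
  let M : Sublattice (familyBitopology S).posLattice :=
    { carrier := {U | ∃ a : L, ∀ q : spec L, a ∈ (q : Set L) ↔ specMap θ h q ∉ (U : Set S)}
      supClosed' := by
        rintro U ⟨a, ha⟩ V ⟨b, hb⟩
        refine ⟨a ⊔ b, fun q => ?_⟩
        rw [sup_mem_spec q.2, ha, hb]
        exact not_or.symm
      infClosed' := by
        rintro U ⟨a, ha⟩ V ⟨b, hb⟩
        refine ⟨a ⊓ b, fun q => ?_⟩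
        rw [inf_mem_spec q.2, ha, hb]
        exact not_and_or.symm }
  have hM : M = ⊤ := by
    refine generates_range_avoiding hS M ⟨⊥, fun q => ?_⟩ ⟨⊤, fun q => ?_⟩ ?_
    · exact iff_of_true (bot_mem_spec q.2) (Set.notMem_empty _)
    · exact iff_of_false (top_notMem_spec q.2) (not_not.2 (Set.mem_univ _))
    · rintro _ ⟨x, rfl⟩
      exact ⟨θ x, fun q => not_not.symm⟩
  exact (hM ▸ Sublattice.mem_top _ : U ∈ M)

/-- The homomorphism `ℒ⁺ → L` induced by a map `θ : X → L` that pulls prime ideals back into `S`. -/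
theorem exists_hom_forall_mem_spec_iff (hS : (familyBitopology S).IsAbstractSpectrum) (θ : X → L)
    (h : ∀ q ∈ spec L, θ ⁻¹' q ∈ S) :
    ∃ l : BoundedLatticeHom (familyBitopology S).posLattice L,
      ∀ U, ∀ q : spec L, l U ∈ (q : Set L) ↔ specMap θ h q ∉ (U : Set S) := by
  -- The specification fixes `l U` uniquely, so each homomorphism law can be checked on prime
  -- ideals.
  choose l hl using exists_forall_mem_spec_iff hS θ h
  refine ⟨⟨⟨⟨l, fun U V => ?_⟩, fun U V => ?_⟩, ?_, ?_⟩, hl⟩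
  · refine eq_of_forall_spec fun q hq => ?_
    rw [sup_mem_spec hq, hl _ ⟨q, hq⟩, hl _ ⟨q, hq⟩, hl _ ⟨q, hq⟩]
    exact not_or
  · refine eq_of_forall_spec fun q hq => ?_
    change l (U ⊓ V) ∈ q ↔ l U ⊓ l V ∈ q
    rw [inf_mem_spec hq, hl _ ⟨q, hq⟩, hl _ ⟨q, hq⟩, hl _ ⟨q, hq⟩]
    exact not_and_or
  · refine eq_of_forall_spec fun q hq => ?_
    exact iff_of_false (fun hmem => (hl ⊤ ⟨q, hq⟩).1 hmem (Set.mem_univ _)) (top_notMem_spec hq)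
  · refine eq_of_forall_spec fun q hq => ?_
    exact iff_of_true ((hl ⊥ ⟨q, hq⟩).2 (Set.notMem_empty _)) (bot_mem_spec hq)

theorem hom_ext_of_generates {L₀ : Type*} [Lattice L₀] [BoundedOrder L₀] {φ : X → L₀}
    (hφ : Generates (Set.range φ)) {l m : BoundedLatticeHom L₀ L} (h : l ∘ φ = m ∘ φ) : l = m := by
  let M : Sublattice L₀ :=
    { carrier := {a | l a = m a}
      supClosed' := fun a ha b hb => by
        change l (a ⊔ b) = m (a ⊔ b)
        rw [map_sup, map_sup, ha, hb]
      infClosed' := fun a ha b hb => by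
        change l (a ⊓ b) = m (a ⊓ b)
        rw [map_inf, map_inf, ha, hb] }
  have hM : M = ⊤ := hφ M ((map_bot l).trans (map_bot m).symm)
    ((map_top l).trans (map_top m).symm) (by rintro _ ⟨x, rfl⟩; exact congrFun h x)
  exact DFunLike.ext _ _ fun a => (hM ▸ Sublattice.mem_top _ : a ∈ M)

end

end Spectra

theorem theorem2p4p1 {X : Type u} (S : Set (Set X))
    (hS : (Spectra.familyBitopology S).IsAbstractSpectrum) :
    ∃ (L : Type u) (_ : DistribLattice L) (_ : BoundedOrder L) (φ : X → L),
      -- the image of `φ` generates `L`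
      Spectra.Generates (Set.range φ) ∧
      -- `q ↦ φ⁻¹(q)` is a well defined isomorphism of abstract spectra `spec L → S`
      (Spectra.familyBitopology (Spectra.spec L)).IsAbstractSpectrum ∧
      (∃ h : ∀ q ∈ Spectra.spec L, φ ⁻¹' q ∈ S,
        (Spectra.familyBitopology (Spectra.spec L)).IsIsomorphism
          (Spectra.familyBitopology S) (Spectra.specMap φ h)) ∧
      -- universal property
      (∀ (L' : Type v) [DistribLattice L'] [BoundedOrder L'] (θ : X → L')
        (h : ∀ q ∈ Spectra.spec L', θ ⁻¹' q ∈ S),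
        (Spectra.familyBitopology (Spectra.spec L')).IsMorphism
          (Spectra.familyBitopology S) (Spectra.specMap θ h) →
        ∃! l : BoundedLatticeHom L L', l ∘ φ = θ) ∧
      -- uniqueness up to a unique lattice isomorphism
      (∀ (L₁ : Type v) [DistribLattice L₁] [BoundedOrder L₁] (φ₁ : X → L₁)
        (h : ∀ q ∈ Spectra.spec L₁, φ₁ ⁻¹' q ∈ S),
        (Spectra.familyBitopology (Spectra.spec L₁)).IsIsomorphism
          (Spectra.familyBitopology S) (Spectra.specMap φ₁ h) →
        ∃! l : BoundedLatticeHom L L₁, Function.Bijective l ∧ l ∘ φ = φ₁) ∧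
      -- injectivity
      (Function.Injective φ ↔
        ∀ x y : X, x ≠ y → ∃ p ∈ S, Xor (x ∈ p) (y ∈ p)) := by
  have hgen := Spectra.generates_range_avoiding hS
  have hiso := Spectra.isIsomorphism_specMap_avoiding hS
  refine ⟨(Spectra.familyBitopology S).posLattice, inferInstance, inferInstance,
    Spectra.avoiding S, hgen, hS.of_isIsomorphism hiso, ⟨_, hiso⟩, ?_, ?_,
    Spectra.avoiding_injective_iff⟩
  · intro L' _ _ θ h _
    obtain ⟨l, hl⟩ := Spectra.exists_hom_forall_mem_spec_iff hS θ h
    have hlθ := Spectra.comp_avoiding_eq hl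
    exact ⟨l, hlθ, fun m hm => Spectra.hom_ext_of_generates hgen (hm.trans hlθ.symm)⟩
  · intro L₁ _ _ φ₁ h hiso₁
    obtain ⟨l, hl⟩ := Spectra.exists_hom_forall_mem_spec_iff hS φ₁ h
    have hlφ := Spectra.comp_avoiding_eq hl
    exact ⟨l, ⟨Spectra.bijective_of_isIsomorphism hiso₁ hl, hlφ⟩,
      fun m hm => Spectra.hom_ext_of_generates hgen (hm.2.trans hlφ.symm)⟩
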